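/- Let $n \ge 1$ be an integer, let $i \in \{1, \ldots, n\}$, and let $I^n = [0,1]^n$ be the unit cube with the topology inherited from $\mathbb{R}^n$. Write $I^n_{i,-} = \{z \in I^n : z_i = 0\}$ and $I^n_{i,+} = \{z \in I^n : z_i = 1\}$. Say that a set $A \subset I^n$ \emph{connects the $i$th opposite faces of $I^n$} if there is a connected set $S \subset A$ with $S \cap I^n_{i,-} \neq \emptyset \neq S \cap I^n_{i,+}$, and that $A$ \emph{separates the $i$th opposite faces of $I^n$} if $I^n \setminus A$ does not connect the $i$th opposite faces of $I^n$. For a function $g \colon I^n \to \mathbb{R}$, let $\mathsf{Conn}_i(g)$ (respectively $\mathsf{Sep}_i(g)$) be the set of all $p \in \mathbb{R}$ such that the fiber $g^{-1}(\{p\})$ connects (respectively separates) the $i$th opposite faces of $I^n$. Then, for every continuous function $g \colon I^n \to \mathbb{R}$, $$\mathsf{Conn}_i(g) \cup \mathsf{Sep}_i(g) \neq \emptyset .$$ -/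

import Mathlib

/-- The `n`-dimensional unit cube `I^n = [0, 1]^n`, with the product topology
(which is the subspace topology inherited from `ℝ^n`). -/
abbrev UnitCube (n : ℕ) : Type := Fin n → unitInterval

namespace UnitCube

/-- The face `{z ∈ I^n | z_i = 0}`. -/
def faceMinus {n : ℕ} (i : Fin n) : Set (UnitCube n) := {z | z i = 0}

/-- The face `{z ∈ I^n | z_i = 1}`. -/
def facePlus {n : ℕ} (i : Fin n) : Set (UnitCube n) := {z | z i = 1}

/-- `A ⊆ I^n` connects the `i`th opposite faces of `I^n`: some connected subset of `A`
meets both of them. -/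
def Connects {n : ℕ} (i : Fin n) (A : Set (UnitCube n)) : Prop :=
  ∃ S : Set (UnitCube n), S ⊆ A ∧ IsConnected S ∧
    (S ∩ faceMinus i).Nonempty ∧ (S ∩ facePlus i).Nonempty

/-- `A ⊆ I^n` separates the `i`th opposite faces of `I^n`: its complement in `I^n` does not
connect them. -/
def Separates {n : ℕ} (i : Fin n) (A : Set (UnitCube n)) : Prop :=
  ¬ Connects i Aᶜ

/-- The set of all `p` such that the fiber of `g` over `p` connects the `i`th opposite faces. -/
def Conn {n : ℕ} (i : Fin n) (g : UnitCube n → ℝ) : Set ℝ :=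
  {p | Connects i (g ⁻¹' {p})}

/-- The set of all `p` such that the fiber of `g` over `p` separates the `i`th opposite faces. -/
def Sep {n : ℕ} (i : Fin n) (g : UnitCube n → ℝ) : Set ℝ :=
  {p | Separates i (g ⁻¹' {p})}

end UnitCube

open Set Topology

/-! If no fiber separates, then for each `p` one of `{g < p}`, `{g > p}` connects the faces. The
levels of each kind form a nonempty open set, so by connectedness of `ℝ` some `p` is of both kinds,
witnessed by connected sets `P` and `Q`. The fiber over this `p` connects (`connects_fiber`).
Otherwise some continuous `ψ` equals `-1` where the fiber meets the face `z i = 0`, `1` where it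
meets `z i = 1`, and `±1` on the whole fiber. Then `F = (g - p) + iψ` has no zero, yet it winds once
around `0` along the circuit made of `P`, one face, `Q` and the other face. This is impossible,
since `F` has a continuous logarithm on the cube. -/

namespace UnitCube

variable {n : ℕ}

/-- The coordinatewise retraction of `ℝ^n` onto the unit cube. -/
noncomputable def retraction (x : Fin n → ℝ) : UnitCube n :=
  fun j => projIcc 0 1 zero_le_one (x j)

theorem continuous_retraction : Continuous (retraction : (Fin n → ℝ) → UnitCube n) :=
  continuous_pi fun j => continuous_projIcc.comp (continuous_apply j)

/-- The inclusion of the unit cube in `ℝ^n`. -/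
def inclusion (z : UnitCube n) : Fin n → ℝ := fun j => z j

theorem continuous_inclusion : Continuous (inclusion : UnitCube n → Fin n → ℝ) := by
  unfold inclusion
  fun_prop

theorem retraction_inclusion (z : UnitCube n) : retraction (inclusion z) = z :=
  funext fun j => projIcc_val zero_le_one (z j)

/-- The retraction is a quotient map from `ℝ^n`, and quotients inherit local path-connectedness. It
makes connected open subsets of the cube path connected. -/
instance : LocallyPathConnectedSpace (UnitCube n) :=
  (IsQuotientMap.of_comp (f := inclusion (n := n)) continuous_inclusion continuous_retraction
    (by
      have h : retraction ∘ inclusion (n := n) = id := funext retraction_inclusion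
      rw [h]
      exact .id)).locallyPathConnectedSpace

/-- A nowhere vanishing continuous function on the cube has a continuous logarithm. -/
theorem exists_continuous_log {F : UnitCube n → ℂ} (hF : Continuous F) (h0 : ∀ z, F z ≠ 0) :
    ∃ h : UnitCube n → ℂ, Continuous h ∧ ∀ z, Complex.exp (h z) = F z := by
  -- Lift on the simply connected `ℝ^n`, where `F` is extended through the retraction, then restrict
  -- to the cube.
  obtain ⟨H, ⟨-, hH⟩, -⟩ := Complex.isCoveringMapOn_exp.existsUnique_continuousMap_lifts
    ⟨F ∘ retraction, hF.comp continuous_retraction⟩ (a₀ := (0 : Fin n → ℝ))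
    (Complex.exp_log (h0 _)) (fun a => h0 _)
  refine ⟨H ∘ inclusion, H.continuous.comp continuous_inclusion, fun z => ?_⟩
  have := congrFun hH (inclusion z)
  simpa [retraction_inclusion] using this

/-- Along a preconnected set on which a rotate `c * F` stays in the slit plane, every continuous
logarithm of `F` has the same increments as the principal branch of `log (c * F)`. -/
theorem _root_.IsPreconnected.sub_eq_log_sub_log {X : Type*} [TopologicalSpace X]
    {F h : X → ℂ} (hF : Continuous F) (hh : Continuous h) (he : ∀ z, Complex.exp (h z) = F z)
    {S : Set X} (hS : IsPreconnected S) {c : ℂ} (hc : ∀ z ∈ S, c * F z ∈ Complex.slitPlane)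
    {x y : X} (hx : x ∈ S) (hy : y ∈ S) :
    h x - h y = Complex.log (c * F x) - Complex.log (c * F y) := by
  -- The additive constant makes this second lift of `F` through `exp` agree with `h` at `y`, hence
  -- on all of `S`.
  have hcont : ContinuousOn (fun z => Complex.log (c * F z) + (h y - Complex.log (c * F y))) S :=
    ((continuous_const.mul hF).continuousOn.clog hc).add continuousOn_const
  have key := Complex.isCoveringMap_exp.eqOn_of_comp_eqOn hS hh.continuousOn hcont
    (fun z hz => Subtype.ext ?_) hy (by ring)
  · have := key hx
    simp only at this
    rw [this]
    ring
  · have h1 := Complex.slitPlane_ne_zero (hc z hz)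
    have h2 := Complex.slitPlane_ne_zero (hc y hy)
    have hc0 : c ≠ 0 := left_ne_zero_of_mul h1
    have hy0 : F y ≠ 0 := right_ne_zero_of_mul h2
    simp only [Function.comp_apply, Complex.exp_add, Complex.exp_sub, Complex.exp_log h1,
      Complex.exp_log h2, he]
    field_simp

/-- In a compact Hausdorff space, if no connected subset of a closed set `K` meets both of the
closed sets `L` and `R`, a continuous function equal to `±1` on `K` tells `K ∩ L` from `K ∩ R`. -/
theorem _root_.IsClosed.exists_continuous_eq_one_or_eq_neg_one {X : Type*} [TopologicalSpace X]
    [CompactSpace X] [T2Space X] {K L R : Set X} (hK : IsClosed K) (hL : IsClosed L)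
    (hR : IsClosed R)
    (h : ∀ S ⊆ K, IsConnected S → (S ∩ L).Nonempty → ¬ (S ∩ R).Nonempty) :
    ∃ ψ : X → ℝ, Continuous ψ ∧ (∀ z ∈ K, ψ z = 1 ∨ ψ z = -1) ∧
      (∀ z ∈ K ∩ L, ψ z = -1) ∧ ∀ z ∈ K ∩ R, ψ z = 1 := by
  have : CompactSpace K := isCompact_iff_compactSpace.mp hK.isCompact
  let q : K → ConnectedComponents K := ConnectedComponents.mk
  have hq : Continuous q := ConnectedComponents.continuous_coe
  have hL' : IsClosed (q '' (Subtype.val ⁻¹' L)) :=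
    hq.isClosedMap _ (hL.preimage continuous_subtype_val)
  have hR' : IsClosed (q '' (Subtype.val ⁻¹' R)) :=
    hq.isClosedMap _ (hR.preimage continuous_subtype_val)
  -- The component space of `K` is profinite, so a clopen set separates the two closed images. They
  -- are disjoint: a common point would be a component of `K` meeting both `L` and `R`.
  obtain ⟨C, hC, hLC, hCR⟩ := exists_clopen_of_closed_subset_open hL' hR'.isOpen_compl (by
    rintro _ ⟨x, hx, rfl⟩ ⟨y, hy, hxy⟩
    refine h (Subtype.val '' connectedComponent x) (by simp)
      (isConnected_connectedComponent.image _ continuous_subtype_val.continuousOn)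
      ⟨x, ⟨x, mem_connectedComponent, rfl⟩, hx⟩
      ⟨y, ⟨y, ConnectedComponents.coe_eq_coe'.mp hxy, rfl⟩, hy⟩)
  have hC' := hC.preimage hq
  obtain ⟨φ, h0, h1, -⟩ := exists_continuous_zero_one_of_isClosed
    (hK.isClosedEmbedding_subtypeVal.isClosedMap _ hC'.isClosed)
    (hK.isClosedEmbedding_subtypeVal.isClosedMap _ hC'.compl.isClosed)
    (by rw [disjoint_image_iff Subtype.val_injective]; exact disjoint_compl_right)
  have hin : ∀ z : K, q z ∈ C → 2 * φ z - 1 = -1 := fun z hz => by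
    have : φ z = 0 := h0 ⟨z, hz, rfl⟩
    rw [this]; norm_num
  have hout : ∀ z : K, q z ∉ C → 2 * φ z - 1 = 1 := fun z hz => by
    have : φ z = 1 := h1 ⟨z, hz, rfl⟩
    rw [this]; norm_num
  refine ⟨fun z => 2 * φ z - 1, by fun_prop, fun z hz => ?_, fun z hz => ?_, fun z hz => ?_⟩
  · by_cases hzC : q ⟨z, hz⟩ ∈ C
    · exact Or.inr (hin ⟨z, hz⟩ hzC)
    · exact Or.inl (hout ⟨z, hz⟩ hzC)
  · exact hin ⟨z, hz.1⟩ (hLC ⟨_, hz.2, rfl⟩)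
  · exact hout ⟨z, hz.1⟩ fun hzC => hCR hzC ⟨_, hz.2, rfl⟩

theorem isConnected_setOf_apply_eq (i : Fin n) (t : unitInterval) :
    IsConnected {z : UnitCube n | z i = t} := by
  have : {z : UnitCube n | z i = t} = range fun z : UnitCube n => Function.update z i t := by
    ext z
    constructor
    · rintro rfl
      exact ⟨z, Function.update_eq_self i z⟩
    · rintro ⟨w, rfl⟩
      simp
  rw [this]
  exact isConnected_range (by fun_prop)

theorem isClosed_setOf_apply_eq (i : Fin n) (t : unitInterval) :
    IsClosed {z : UnitCube n | z i = t} :=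
  isClosed_eq (continuous_apply i) continuous_const

theorem Connects.mono {i : Fin n} {A B : Set (UnitCube n)} (hAB : A ⊆ B) (h : Connects i A) :
    Connects i B :=
  let ⟨S, hSA, hS⟩ := h
  ⟨S, hSA.trans hAB, hS⟩

/-- If an open sublevel set connects opposite faces, so does a strictly smaller one. -/
theorem Connects.exists_lt {i : Fin n} {g : UnitCube n → ℝ} (hg : Continuous g) {a : ℝ}
    (h : Connects i {z | g z < a}) : ∃ b < a, Connects i {z | g z < b} := by
  obtain ⟨S, hSa, hS, ⟨x, hxS, hx⟩, ⟨y, hyS, hy⟩⟩ := h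
  have hopen : IsOpen {z | g z < a} := isOpen_lt hg continuous_const
  have hconn : IsConnected (connectedComponentIn {z | g z < a} x) :=
    isConnected_connectedComponentIn_iff.mpr (hSa hxS)
  obtain ⟨γ, hγ⟩ := (hopen.connectedComponentIn.isConnected_iff_isPathConnected.mp hconn).joinedIn
    x (mem_connectedComponentIn (hSa hxS)) y
    (hS.isPreconnected.subset_connectedComponentIn hxS hSa hyS)
  -- On a compact path `g` attains its maximum, which is therefore still below `a`.
  obtain ⟨t, -, ht⟩ := isCompact_univ.exists_isMaxOn univ_nonempty
    (hg.comp γ.continuous).continuousOn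
  have hta : γ t ∈ {z | g z < a} := connectedComponentIn_subset _ _ (hγ t)
  obtain ⟨b, htb, hba⟩ := exists_between (show g (γ t) < a from hta)
  refine ⟨b, hba, range γ, ?_, isConnected_range γ.continuous, ⟨x, ⟨0, γ.source⟩, hx⟩,
    ⟨y, ⟨1, γ.target⟩, hy⟩⟩
  rintro _ ⟨s, rfl⟩
  exact (ht (mem_univ s)).trans_lt htb

theorem isOpen_setOf_connects_lt (i : Fin n) {g : UnitCube n → ℝ} (hg : Continuous g) :
    IsOpen {p | Connects i {z | g z < p}} := by
  refine isOpen_iff_mem_nhds.mpr fun a ha => ?_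
  obtain ⟨b, hba, hb⟩ := Connects.exists_lt hg ha
  filter_upwards [Ioi_mem_nhds hba] with p hp
  exact Connects.mono (B := {z | g z < p})
    (fun z (hz : g z < b) => lt_trans hz hp) hb

theorem isOpen_setOf_connects_gt (i : Fin n) {g : UnitCube n → ℝ} (hg : Continuous g) :
    IsOpen {p | Connects i {z | p < g z}} := by
  have := (isOpen_setOf_connects_lt i hg.neg).preimage continuous_neg
  simpa only [preimage_ofPred_eq, neg_lt_neg_iff, Pi.neg_apply] using this

theorem connects_univ (i : Fin n) : Connects i univ :=
  ⟨univ, subset_rfl, isConnected_univ,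
    ⟨fun _ => 0, mem_univ _, rfl⟩, ⟨fun _ => 1, mem_univ _, rfl⟩⟩

/-- If the strict sublevel and superlevel sets of `g` at `p` both connect opposite faces, then so
does the fiber over `p`. -/
theorem connects_fiber {i : Fin n} {g : UnitCube n → ℝ} (hg : Continuous g) {p : ℝ}
    (hlt : Connects i {z | g z < p}) (hgt : Connects i {z | p < g z}) :
    Connects i (g ⁻¹' {p}) := by
  by_contra hcon
  obtain ⟨P, hPp, hP, ⟨x, hxP, hx⟩, hPR⟩ := hlt
  obtain ⟨Q, hQp, hQ, ⟨y, hyQ, hy⟩, hQR⟩ := hgt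
  obtain ⟨ψ, hψ, hψK, hψL, hψR⟩ :=
    (isClosed_singleton.preimage hg).exists_continuous_eq_one_or_eq_neg_one
      (isClosed_setOf_apply_eq i 0) (isClosed_setOf_apply_eq i 1)
      fun S hSK hS hSL hSR => hcon ⟨S, hSK, hS, hSL, hSR⟩
  let F : UnitCube n → ℂ := fun z => ⟨g z - p, ψ z⟩
  have hF : Continuous F := by
    have : F = fun z => ((g z - p : ℝ) : ℂ) + (ψ z : ℂ) * Complex.I :=
      funext fun z => Complex.mk_eq_add_mul_I _ _
    rw [this]
    fun_prop
  have hF0 : ∀ z, F z ≠ 0 := fun z hz => by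
    have h1 : g z - p = 0 := congrArg Complex.re hz
    have h2 : ψ z = 0 := congrArg Complex.im hz
    rcases hψK z (sub_eq_zero.mp h1) with h | h <;> norm_num [h] at h2
  obtain ⟨h, hh, he⟩ := exists_continuous_log hF hF0
  have hconnected : ∀ T : Set (UnitCube n), IsConnected T → (P ∩ T).Nonempty → (Q ∩ T).Nonempty →
      IsPreconnected (P ∪ T ∪ Q) := fun T hT hPT hQT =>
    ((hP.union hPT hT).union (by
      obtain ⟨z, hzQ, hzT⟩ := hQT
      exact ⟨z, Or.inr hzT, hzQ⟩) hQ).isPreconnected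
  -- `-I * F` has real part `ψ` and imaginary part `p - g`. On `P`, `Q` and the face `z i = 1`, the
  -- latter vanishes only where `ψ = 1`, so the slit is avoided. On the opposite face `ψ = -1`
  -- there, hence the factor `I`.
  have hR := (hconnected _ (isConnected_setOf_apply_eq i 1) hPR hQR).sub_eq_log_sub_log
    hF hh he (c := -Complex.I) ?_ (Or.inl (Or.inl hxP)) (Or.inr hyQ)
  · have hL := (hconnected _ (isConnected_setOf_apply_eq i 0) ⟨x, hxP, hx⟩
      ⟨y, hyQ, hy⟩).sub_eq_log_sub_log
      hF hh he (c := Complex.I) ?_ (Or.inl (Or.inl hxP)) (Or.inr hyQ)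
    · have hgx : g x < p := hPp hxP
      have hgy : p < g y := hQp hyQ
      have h1 : 0 ≤ (-Complex.I * F x).arg := Complex.arg_nonneg_iff.mpr (by simp [F, hgx.le])
      have h2 : (-Complex.I * F y).arg < 0 := Complex.arg_neg_iff.mpr (by simp [F, hgy])
      have h3 : (Complex.I * F x).arg < 0 := Complex.arg_neg_iff.mpr (by simp [F, hgx])
      have h4 : 0 ≤ (Complex.I * F y).arg := Complex.arg_nonneg_iff.mpr (by simp [F, hgy.le])
      have := congrArg Complex.im (hR.symm.trans hL)
      simp only [Complex.sub_im, Complex.log_im] at this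
      linarith
    · intro z hz
      rw [Complex.mem_slitPlane_iff]
      by_cases hzp : g z = p
      · left
        rcases hz with (hz | hz) | hz
        · exact absurd hzp (hPp hz).ne
        · simp [F, hψL z ⟨hzp, hz⟩]
        · exact absurd hzp (hQp hz).ne'
      · right
        simpa [F, sub_eq_zero] using hzp
  · intro z hz
    rw [Complex.mem_slitPlane_iff]
    by_cases hzp : g z = p
    · left
      rcases hz with (hz | hz) | hz
      · exact absurd hzp (hPp hz).ne
      · simp [F, hψR z ⟨hzp, hz⟩]
      · exact absurd hzp (hQp hz).ne'
    · right
      simpa [F, sub_eq_zero, eq_comm] using hzp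

/-- A connected subset of the complement of a fiber lies strictly below or strictly above it. -/
theorem connects_lt_or_connects_gt {i : Fin n} {g : UnitCube n → ℝ} (hg : Continuous g) {p : ℝ}
    (h : Connects i (g ⁻¹' {p})ᶜ) :
    Connects i {z | g z < p} ∨ Connects i {z | p < g z} := by
  obtain ⟨S, hSp, hS, hSL, hSR⟩ := h
  have hcover : S ⊆ {z | g z < p} ∪ {z | p < g z} := fun z hz => lt_or_gt_of_ne (hSp hz)
  rcases hS.isPreconnected.subset_or_subset (isOpen_lt hg continuous_const)
    (isOpen_lt continuous_const hg)
    (disjoint_left.mpr fun z (h1 : g z < p) (h2 : p < g z) => lt_asymm h1 h2) hcover with h | h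
  · exact Or.inl ⟨S, h, hS, hSL, hSR⟩
  · exact Or.inr ⟨S, h, hS, hSL, hSR⟩

end UnitCube

theorem mainTheorem5 (n : ℕ) (i : Fin n) (g : UnitCube n → ℝ) (hg : Continuous g) :
    (UnitCube.Conn i g ∪ UnitCube.Sep i g).Nonempty := by
  by_cases hsep : (UnitCube.Sep i g).Nonempty
  · exact hsep.inr
  have hcover : ∀ p, UnitCube.Connects i {z | g z < p} ∨ UnitCube.Connects i {z | p < g z} :=
    fun p => UnitCube.connects_lt_or_connects_gt hg (not_not.mp fun hp => hsep ⟨p, hp⟩)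
  obtain ⟨M, hM⟩ := (isCompact_range hg).bddAbove
  obtain ⟨m, hm⟩ := (isCompact_range hg).bddBelow
  -- Both sets of levels are nonempty because `g` is bounded: beyond its range, the sublevel or
  -- superlevel set is the whole cube.
  obtain ⟨p, -, hlt, hgt⟩ := isPreconnected_univ _ _ (UnitCube.isOpen_setOf_connects_lt i hg)
    (UnitCube.isOpen_setOf_connects_gt i hg) (fun p _ => hcover p)
    ⟨M + 1, mem_univ _, (UnitCube.connects_univ i).mono fun z _ =>
      (hM (mem_range_self z)).trans_lt (lt_add_one M)⟩
    ⟨m - 1, mem_univ _, (UnitCube.connects_univ i).mono fun z _ =>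
      (sub_one_lt m).trans_le (hm (mem_range_self z))⟩
  exact ⟨p, Or.inl (UnitCube.connects_fiber hg hlt hgt)⟩
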